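/- Manifolds are finite-dimensional, smooth, Hausdorff, second countable and without boundary. Let $\mathcal G\rightrightarrows M$ be a Lie groupoid with source $s$ and target $t$ ($g.h$ is defined when $s(g)=t(h)$). A bisection is a smooth $\beta\colon M\to\mathcal G$ with $s\circ\beta=\mathrm{id}_M$ and $t\circ\beta\in\mathrm{Diff}(M)$; bisections multiply by $(\beta_2\cdot\beta_1)(m)=\beta_2(t(\beta_1(m))).\beta_1(m)$, act on $\mathcal G$ by $L_\beta(g)=\beta(t(g)).g$ and on $M$ by the shadow action $t_*\beta=t\circ\beta$. A principaloid $\mathcal G$-bundle is a surjective submersion $\pi\colon\mathcal P\to\Sigma$ with a smooth map $\mu\colon\mathcal P\to M$ and a smooth right $\mathcal G$-action $\varrho\colon\mathcal P\,{}_\mu\!\times_t\mathcal G\to\mathcal P$, $(p,g)\mapsto p\blacktriangleleft g$, with moment map $\mu$ (so $\mu(p\blacktriangleleft g)=s(g)$, $p\blacktriangleleft\mathrm{Id}_{\mu(p)}=p$ and $(p\blacktriangleleft g)\blacktriangleleft h=p\blacktriangleleft(g.h)$), which preserves the fibres of $\pi$, and such that $\Sigma$ is covered by open sets $O$ with $\mathcal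 G$-equivariant diffeomorphic local trivialisations $\pi^{-1}(O)\cong O\times\mathcal G$ over $O$, where $\mathcal G$ acts on $\mathcal G$ by right multiplication. **Theorem A.** Let $\mathcal P\to\Sigma$ be a principaloid $\mathcal G$-bundle. (1) Any family of $\mathcal G$-equivariant local trivialisations $\tau_i\colon\pi^{-1}(O_i)\to O_i\times\mathcal G$ over an open cover has a transition cocycle: maps $\beta_{ij}$ from $O_i\cap O_j$ to the bisections, with $(\sigma,m)\mapsto\beta_{ij}(\sigma)(m)$ smooth, $\tau_i\circ\tau_j^{-1}(\sigma,g)=(\sigma,L_{\beta_{ij}(\sigma)}(g))$, and $\beta_{ij}\cdot\beta_{jk}=\beta_{ik}$ on triple overlaps. (2) There are a smooth fibre bundle $\pi_{\mathcal F}\colon\mathcal F\to\Sigma$ with typical fibre $M$ (the shadow of $\mathcal P$) and a map $\mathcal D\colon\mathcal P\to\mathcal F$ (the sitting-duck map) with $\pi_{\mathcal F}\circ\mathcal D=\pi$, such that for every family $(\tau_i)$ with cocycle $(\beta_{ij})$ as in (1), $\mathcal F$ has smooth local trivialisations $\mathcal F\tau_i\colon\pi_{\mathcal F}^{-1}(O_i)\to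 O_i\times M$ with $\mathcal F\tau_i\circ\mathcal F\tau_j^{-1}(\sigma,m)=(\sigma,t_*\beta_{ij}(\sigma)(m))$, whose inverses induce a homeomorphism $\bigsqcup_i(O_i\times M)/{\sim_{t_*\beta}}\cong\mathcal F$, and $\mathcal D(\tau_i^{-1}(\sigma,g))=\mathcal F\tau_i^{-1}(\sigma,t(g))$. Here $\sim_{t_*\beta}$ identifies $(\sigma,m)$ in the $i$-th piece with $(\sigma,t_*\beta_{ji}(\sigma)(m))$ in the $j$-th piece for $\sigma\in O_i\cap O_j$. (3) $(\mathcal P,\mathcal F,\mathcal D,\mu,\varrho)$ is a principal $\mathcal G$-bundle over $\mathcal F$, in the category of bundles over $\Sigma$: $\mathcal D$ is a surjective submersion over $\Sigma$, $\mathcal D(p\blacktriangleleft g)=\mathcal D(p)$, the action preserves the fibres of $\pi$, and $(\mathrm{pr}_1,\varrho)\colon\mathcal P\,{}_\mu\!\times_t\mathcal G\to\mathcal P\times_{\mathcal F}\mathcal P$ is a diffeomorphism. In particular the fibres of $\mathcal D$ are the $\mathcal G$-orbits. (4) There is a smooth division map $\phi\colon\mathcal P\times_{\mathcal F}\mathcal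 P\to\mathcal G$ with $(\mathrm{pr}_1,\phi)=(\mathrm{pr}_1,\varrho)^{-1}$; it is the only map with $t(\phi(p_1,p_2))=\mu(p_1)$ and $p_2=p_1\blacktriangleleft\phi(p_1,p_2)$. (5) The construction is canonical: if $(\mathcal F',\pi_{\mathcal F'},\mathcal D')$ has the properties of (2) for at least one family $(\tau_i)$ and its cocycle, then there is a unique diffeomorphism $\Phi\colon\mathcal F\to\mathcal F'$ with $\Phi\circ\mathcal D=\mathcal D'$ and $\pi_{\mathcal F'}\circ\Phi=\pi_{\mathcal F}$. -/

import Mathlib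

open Set
open scoped Manifold ContDiff Topology

/-! Manifolds are finite-dimensional, real, smooth, without boundary. Groupoid conventions:
`s` is the source, `t` the target, and `g.h` is defined when `s g = t h`.

Maps which the mathematics defines only on a fibre product (a closed embedded submanifold of a
product) are total functions here. Their values off the fibre product are never used, and their
smoothness is `ContMDiffOn` on the fibre product, that is, smoothness for the submanifold
structure. -/

section Generalities

variable {E₁ H₁ E₂ H₂ E₃ H₃ : Type*}
  [NormedAddCommGroup E₁] [NormedSpace ℝ E₁] [TopologicalSpace H₁]
  [NormedAddCommGroup E₂] [NormedSpace ℝ E₂] [TopologicalSpace H₂]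
  [NormedAddCommGroup E₃] [NormedSpace ℝ E₃] [TopologicalSpace H₃]
  (I₁ : ModelWithCorners ℝ E₁ H₁) (I₂ : ModelWithCorners ℝ E₂ H₂) (I₃ : ModelWithCorners ℝ E₃ H₃)
  {X Y Z : Type*}
  [TopologicalSpace X] [ChartedSpace H₁ X]
  [TopologicalSpace Y] [ChartedSpace H₂ Y]
  [TopologicalSpace Z] [ChartedSpace H₃ Z]

/-- A surjective submersion of finite-dimensional manifolds. -/
structure IsSurjectiveSubmersion (f : X → Y) : Prop where
  contMDiff : ContMDiff I₁ I₂ ∞ f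
  surjective : Function.Surjective f
  mfderiv_surjective : ∀ x : X, Function.Surjective (mfderiv I₁ I₂ f x)

/-- `f` restricts to a diffeomorphism from the submanifold `A` onto the submanifold `B`. -/
def IsDiffeoBetween (f : X → Y) (A : Set X) (B : Set Y) : Prop :=
  ContMDiffOn I₁ I₂ ∞ f A ∧ MapsTo f A B ∧
    ∃ k : Y → X, ContMDiffOn I₂ I₁ ∞ k B ∧ MapsTo k B A ∧ LeftInvOn k f A ∧ RightInvOn k f B

/-- A local trivialisation `π⁻¹(O) ≅ O × F` (with `O` open) is smooth if it is a diffeomorphism.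
Here `X` is the total space, `Y` the base, `Z` the typical fibre. -/
structure IsSmoothTrivialization {π : X → Y} (e : Bundle.Trivialization Z π) : Prop where
  contMDiffOn : ContMDiffOn I₁ (I₂.prod I₃) ∞ e e.source
  contMDiffOn_symm : ContMDiffOn (I₂.prod I₃) I₁ ∞ e.toOpenPartialHomeomorph.symm e.target

variable (Z) in
/-- `π : X → Y` is a smooth fibre bundle with typical fibre `Z`. -/
structure IsSmoothFibreBundle (π : X → Y) : Prop where
  submersion : IsSurjectiveSubmersion I₁ I₂ π
  locallyTrivial : ∀ y : Y, ∃ e : Bundle.Trivialization Z π,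
    y ∈ e.baseSet ∧ IsSmoothTrivialization I₁ I₂ I₃ e

/-- The fibred square `X ×_Y X` of `f : X → Y`. -/
def fibredSquare (f : X → Y) : Set (X × X) := {q | f q.1 = f q.2}

end Generalities

section Groupoids

variable (EM EG : Type*)
  [NormedAddCommGroup EM] [NormedSpace ℝ EM] [NormedAddCommGroup EG] [NormedSpace ℝ EG]
  (M G : Type*) [TopologicalSpace M] [ChartedSpace EM M] [TopologicalSpace G] [ChartedSpace EG G]

/-- A Lie groupoid with object manifold `M` and arrow manifold `G`. -/
structure LieGroupoid where
  s : G → M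
  t : G → M
  one : M → G
  inv : G → G
  /-- `mul g h` is `g.h`, meaningful when `s g = t h`. -/
  mul : G → G → G
  s_one : ∀ m, s (one m) = m
  t_one : ∀ m, t (one m) = m
  s_mul : ∀ g h, s g = t h → s (mul g h) = s h
  t_mul : ∀ g h, s g = t h → t (mul g h) = t g
  mul_assoc : ∀ g h k, s g = t h → s h = t k → mul (mul g h) k = mul g (mul h k)
  one_mul : ∀ g, mul (one (t g)) g = g
  mul_one : ∀ g, mul g (one (s g)) = g
  s_inv : ∀ g, s (inv g) = t g
  t_inv : ∀ g, t (inv g) = s g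
  mul_inv : ∀ g, mul g (inv g) = one (t g)
  inv_mul : ∀ g, mul (inv g) g = one (s g)
  submersion_s : IsSurjectiveSubmersion 𝓘(ℝ, EG) 𝓘(ℝ, EM) s
  submersion_t : IsSurjectiveSubmersion 𝓘(ℝ, EG) 𝓘(ℝ, EM) t
  contMDiff_one : ContMDiff 𝓘(ℝ, EM) 𝓘(ℝ, EG) ∞ one
  contMDiff_inv : ContMDiff 𝓘(ℝ, EG) 𝓘(ℝ, EG) ∞ inv
  contMDiffOn_mul : ContMDiffOn (𝓘(ℝ, EG).prod 𝓘(ℝ, EG)) 𝓘(ℝ, EG) ∞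
    (fun q : G × G => mul q.1 q.2) {q | s q.1 = t q.2}

end Groupoids

section Bundles

variable {EM EG : Type*}
  [NormedAddCommGroup EM] [NormedSpace ℝ EM] [NormedAddCommGroup EG] [NormedSpace ℝ EG]
  {M G : Type*} [TopologicalSpace M] [ChartedSpace EM M] [TopologicalSpace G] [ChartedSpace EG G]

namespace LieGroupoid

variable (𝒢 : LieGroupoid EM EG M G)

/-- `β` is a (global) bisection: a smooth section of `s` such that `t ∘ β` is a diffeomorphism. -/
structure IsBisection (β : M → G) : Prop where
  contMDiff : ContMDiff 𝓘(ℝ, EM) 𝓘(ℝ, EG) ∞ β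
  s_apply : ∀ m, 𝒢.s (β m) = m
  diffeo : ∃ Φ : Diffeomorph 𝓘(ℝ, EM) 𝓘(ℝ, EM) M M ∞, ∀ m, Φ m = 𝒢.t (β m)

/-- The product `β₂ · β₁` in the group of bisections. -/
def bisectionMul (β₂ β₁ : M → G) : M → G := fun m => 𝒢.mul (β₂ (𝒢.t (β₁ m))) (β₁ m)

/-- Left multiplication `L_β(g) = β(t(g)).g` of arrows by a bisection. -/
def leftMul (β : M → G) (g : G) : G := 𝒢.mul (β (𝒢.t g)) g

/-- The shadow action `t_*β(m) = t(β(m))` of bisections on the object manifold. -/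
def shadowAct (β : M → G) (m : M) : M := 𝒢.t (β m)

end LieGroupoid

variable (𝒢 : LieGroupoid EM EG M G)
  {EP : Type*} [NormedAddCommGroup EP] [NormedSpace ℝ EP]
  (P : Type*) [TopologicalSpace P] [ChartedSpace EP P]

/-- The structure of a right `𝒢`-module on the manifold `P`: a moment map `μ` and a right action
`(p, g) ↦ p ◂ g`, meaningful when `μ p = t g`. -/
structure RightModule where
  μ : P → M
  act : P → G → P
  contMDiff_μ : ContMDiff 𝓘(ℝ, EP) 𝓘(ℝ, EM) ∞ μ
  contMDiffOn_act : ContMDiffOn (𝓘(ℝ, EP).prod 𝓘(ℝ, EG)) 𝓘(ℝ, EP) ∞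
    (fun q : P × G => act q.1 q.2) {q | μ q.1 = 𝒢.t q.2}
  μ_act : ∀ p g, μ p = 𝒢.t g → μ (act p g) = 𝒢.s g
  act_one : ∀ p, act p (𝒢.one (μ p)) = p
  act_act : ∀ p g h, μ p = 𝒢.t g → 𝒢.s g = 𝒢.t h → act (act p g) h = act p (𝒢.mul g h)

variable {𝒢 P}

namespace RightModule

variable (X : RightModule 𝒢 (EP := EP) P)

/-- The domain `P ×_{μ,t} 𝒢` of the action. -/
def actDomain : Set (P × G) := {q | X.μ q.1 = 𝒢.t q.2}

variable {EB HB : Type*} [NormedAddCommGroup EB] [NormedSpace ℝ EB] [TopologicalSpace HB]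
  (IB : ModelWithCorners ℝ EB HB) {B : Type*} [TopologicalSpace B] [ChartedSpace HB B]

/-- `(P, B, D, μ, ϱ)` is a right principal `𝒢`-bundle with base `B` and base projection `D`. -/
structure IsPrincipalBundle (D : P → B) : Prop where
  submersion : IsSurjectiveSubmersion 𝓘(ℝ, EP) IB D
  invariant : ∀ p g, X.μ p = 𝒢.t g → D (X.act p g) = D p
  diffeo : IsDiffeoBetween (𝓘(ℝ, EP).prod 𝓘(ℝ, EG)) (𝓘(ℝ, EP).prod 𝓘(ℝ, EP))
    (fun q : P × G => (q.1, X.act q.1 q.2)) X.actDomain (fibredSquare D)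

/-- `φ : P ×_B P → 𝒢` is a smooth division map: `(pr₁, φ)` is inverse to `(pr₁, ϱ)`. -/
structure IsDivisionMap (D : P → B) (φ : P × P → G) : Prop where
  contMDiffOn : ContMDiffOn (𝓘(ℝ, EP).prod 𝓘(ℝ, EP)) 𝓘(ℝ, EG) ∞ φ (fibredSquare D)
  t_apply : ∀ p₁ p₂, D p₁ = D p₂ → 𝒢.t (φ (p₁, p₂)) = X.μ p₁
  act_apply : ∀ p₁ p₂, D p₁ = D p₂ → X.act p₁ (φ (p₁, p₂)) = p₂
  apply_act : ∀ p g, X.μ p = 𝒢.t g → φ (p, X.act p g) = g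

end RightModule

variable {ES : Type*} [NormedAddCommGroup ES] [NormedSpace ℝ ES]
  {S : Type*} [TopologicalSpace S] [ChartedSpace ES S]

/-- A local trivialisation `τ : π⁻¹(O) ≅ O × 𝒢` is `𝒢`-equivariant for the given module structure on
the total space and the right translations on `𝒢`. -/
def IsEquivariantTrivialization (X : RightModule 𝒢 (EP := EP) P) {π : P → S}
    (e : Bundle.Trivialization G π) : Prop :=
  ∀ σ ∈ e.baseSet, ∀ g h : G,
    (𝒢.s g = 𝒢.t h ↔ X.μ (e.toOpenPartialHomeomorph.symm (σ, g)) = 𝒢.t h) ∧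
    (𝒢.s g = 𝒢.t h → X.act (e.toOpenPartialHomeomorph.symm (σ, g)) h =
      e.toOpenPartialHomeomorph.symm (σ, 𝒢.mul g h))

variable (𝒢 EP P ES S) in
/-- A principaloid `𝒢`-bundle `P → S`: a fibre bundle with a fibrewise right `𝒢`-action which is
locally, by `𝒢`-equivariant trivialisations, the right `𝒢`-module `𝒢`. -/
structure PrincipaloidBundle extends RightModule 𝒢 (EP := EP) P where
  π : P → S
  submersion_π : IsSurjectiveSubmersion 𝓘(ℝ, EP) 𝓘(ℝ, ES) π
  π_act : ∀ p g, μ p = 𝒢.t g → π (act p g) = π p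
  locallyTrivial : ∀ σ : S, ∃ e : Bundle.Trivialization G π, σ ∈ e.baseSet ∧
    IsSmoothTrivialization 𝓘(ℝ, EP) 𝓘(ℝ, ES) 𝓘(ℝ, EG) e ∧
    IsEquivariantTrivialization toRightModule e

namespace PrincipaloidBundle

variable (Q : PrincipaloidBundle 𝒢 EP P ES S)
  {ι : Type*} (e : ι → Bundle.Trivialization G Q.π)

/-- The `e i` are smooth `𝒢`-equivariant local trivialisations over an open cover of the base. -/
structure IsTrivializingFamily : Prop where
  cover : ∀ σ : S, ∃ i, σ ∈ (e i).baseSet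
  smooth : ∀ i, IsSmoothTrivialization 𝓘(ℝ, EP) 𝓘(ℝ, ES) 𝓘(ℝ, EG) (e i)
  equivariant : ∀ i, IsEquivariantTrivialization Q.toRightModule (e i)

/-- `β i j`, on `O_i ∩ O_j`, is the transition cocycle of the trivialisations `e i`: it is smooth, has
values in the bisections, satisfies `e_i ∘ e_j⁻¹ (σ, g) = (σ, L_{β_ij(σ)} g)` and the cocycle
condition `β_ij · β_jk = β_ik`. -/
structure IsTransitionCocycle (β : ι → ι → S → M → G) : Prop where
  bisection : ∀ i j, ∀ σ ∈ (e i).baseSet ∩ (e j).baseSet, 𝒢.IsBisection (β i j σ)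
  smooth : ∀ i j, ContMDiffOn (𝓘(ℝ, ES).prod 𝓘(ℝ, EM)) 𝓘(ℝ, EG) ∞
    (fun x : S × M => β i j x.1 x.2) (((e i).baseSet ∩ (e j).baseSet) ×ˢ univ)
  transition : ∀ i j, ∀ σ ∈ (e i).baseSet ∩ (e j).baseSet, ∀ g : G,
    e i ((e j).toOpenPartialHomeomorph.symm (σ, g)) = (σ, 𝒢.leftMul (β i j σ) g)
  cocycle : ∀ i j k, ∀ σ ∈ (e i).baseSet ∩ (e j).baseSet ∩ (e k).baseSet,
    𝒢.bisectionMul (β i j σ) (β j k σ) = β i k σ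

/-- The relation on `⨆ O_i × M` which identifies `(σ, m)` in the `i`-th piece with
`(σ, t_*β_ji(σ)(m))` in the `j`-th piece, for `σ ∈ O_i ∩ O_j`. -/
def gluingRel (β : ι → ι → S → M → G) (x y : Σ i : ι, (e i).baseSet × M) : Prop :=
  (x.2.1 : S) = (y.2.1 : S) ∧ y.2.2 = 𝒢.shadowAct (β y.1 x.1 (x.2.1 : S)) x.2.2

/-- The model `⨆ O_i × M / ∼` with the quotient topology. -/
abbrev GluedShadow (β : ι → ι → S → M → G) : Type _ := Quot (Q.gluingRel e β)

variable {F : Type*} [TopologicalSpace F] [ChartedSpace (ModelProd ES EM) F]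

/-- `πF : F → S` is the bundle with typical fibre `M` glued from the cocycle `β` by the shadow
action, and `D : P → F` is the map which is `(σ, g) ↦ (σ, t g)` in the trivialisations. -/
def IsShadow (β : ι → ι → S → M → G) (πF : F → S) (D : P → F) : Prop :=
  ∃ τ : ι → Bundle.Trivialization M πF,
    (∀ i, (τ i).baseSet = (e i).baseSet) ∧
    (∀ i, IsSmoothTrivialization (𝓘(ℝ, ES).prod 𝓘(ℝ, EM)) 𝓘(ℝ, ES) 𝓘(ℝ, EM) (τ i)) ∧
    (∀ i j, ∀ σ ∈ (e i).baseSet ∩ (e j).baseSet, ∀ m : M,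
      τ i ((τ j).toOpenPartialHomeomorph.symm (σ, m)) = (σ, 𝒢.shadowAct (β i j σ) m)) ∧
    (∃ Ψ : Q.GluedShadow e β ≃ₜ F, ∀ (i : ι) (σ : (e i).baseSet) (m : M),
      Ψ (Quot.mk _ ⟨i, (σ, m)⟩) = (τ i).toOpenPartialHomeomorph.symm ((σ : S), m)) ∧
    (∀ i, ∀ σ ∈ (e i).baseSet, ∀ g : G,
      D ((e i).toOpenPartialHomeomorph.symm (σ, g)) =
        (τ i).toOpenPartialHomeomorph.symm (σ, 𝒢.t g))

end PrincipaloidBundle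

end Bundles

universe u v w

/-!
The shadow is the orbit space `F = P / 𝒢` and the sitting-duck map is the quotient map. In an
equivariant trivialisation `e` over `O` the orbits in `O × 𝒢` are the fibres of
`(σ, g) ↦ (σ, t g)`: right multiplication preserves `t`, and if `t a = t b` then `a⁻¹.b` carries `a`
to `b` (`IsEquivariantTrivialization.orbit_iff`). Hence `e` induces a homeomorphism from the part of
`F` over `O` onto `O × M`, with inverse `(σ, m) ↦ [e⁻¹(σ, 1_m)]` (`shadowTrivialization`). No
openness of `t` is needed, since a quotient map stays a quotient map over an open subset of its
target.

An equivariant map of `𝒢` to itself is determined by its values on units, because `g = 1_{t g}.g`.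
So the change of trivialisations over `σ` is left multiplication by the arrows
`(e' ∘ e⁻¹)(σ, 1_m)`, and these form a bisection because its inverse has the same form
(`transition_eq_leftMul`, `isBisection_transitionArrow`). The induced change of trivialisations of
`F` is `(σ, m) ↦ (σ, t((e' ∘ e⁻¹)(σ, 1_m)))`, which is smooth. This makes `F` a manifold in which
all induced trivialisations are smooth, and the sitting-duck map is locally `id × t`, a submersion.

The division map is `((σ, a), (σ, b)) ↦ a⁻¹.b` in any trivialisation
(`IsEquivariantTrivialization.eq_inv_mul`), which gives its smoothness and uniqueness together.
Finally, the map `D'` of any other shadow has the same fibres as the sitting-duck map and the same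
local form, so it descends to a bijection of shadows which is the identity in local trivialisations
(`existsUnique_diffeomorph_of_isShadow`).
-/

/-! ### Manifold structures from compatible charts with values in a manifold -/

section ManifoldFromLocalHomeomorphs

variable {E H N F : Type*} [NormedAddCommGroup E] [NormedSpace ℝ E] [TopologicalSpace H]
  (I : ModelWithCorners ℝ E H) [TopologicalSpace N] [ChartedSpace H N] [TopologicalSpace F]

/-- The charted space structure on `F` determined by local homeomorphisms `φ x` into a manifold `N`
around each `x`: its charts are the `φ x` followed by charts of `N`. -/
@[reducible]
def chartedSpaceOfLocalHomeomorphs (φ : F → OpenPartialHomeomorph F N)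
    (hφ : ∀ x, x ∈ (φ x).source) : ChartedSpace H F where
  atlas := range fun x => φ x ≫ₕ chartAt H (φ x x)
  chartAt x := φ x ≫ₕ chartAt H (φ x x)
  mem_chart_source x := by simp [hφ x]
  chart_mem_atlas x := mem_range_self x

/-- In the model space, smoothness as a map of manifolds is smoothness of the coordinate
expression. -/
theorem ContMDiffOn.contDiffOn_model {f : H → H} {s : Set H} (hf : ContMDiffOn I I ∞ f s) :
    ContDiffOn ℝ ∞ (I ∘ f ∘ I.symm) (I.symm ⁻¹' s ∩ range I) := by
  rintro _ ⟨hy, y, rfl⟩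
  have h := (contMDiffWithinAt_iff.1 (hf y (by simpa using hy))).2
  simpa [Function.comp_def, chartAt_self_eq] using h

variable [IsManifold I ∞ N]

theorem isManifold_ofLocalHomeomorphs (φ : F → OpenPartialHomeomorph F N)
    (hφ : ∀ x, x ∈ (φ x).source)
    (hcomp : ∀ x y, ContMDiffOn I I ∞ (φ y ∘ (φ x).symm) ((φ x).symm ≫ₕ φ y).source) :
    @IsManifold _ _ _ _ _ _ _ I ∞ F _ (chartedSpaceOfLocalHomeomorphs φ hφ) := by
  let _ := chartedSpaceOfLocalHomeomorphs (H := H) φ hφ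
  refine isManifold_of_contDiffOn I ∞ F ?_
  rintro _ _ ⟨x, rfl⟩ ⟨y, rfl⟩
  refine ContMDiffOn.contDiffOn_model I ?_
  have h1 := contMDiffOn_chart_symm (I := I) (n := ∞) (x := φ x x)
  have h2 := contMDiffOn_chart (I := I) (n := ∞) (x := φ y y)
  have h3 := (h2.comp' ((hcomp x y).comp' h1))
  refine h3.mono ?_
  intro z hz
  simp only [mfld_simps] at hz ⊢
  tauto

/-- A local homeomorphism which is compatible with all `φ x` is smooth for the manifold structure
defined by the `φ x`. -/
theorem contMDiffOn_of_compatible (φ : F → OpenPartialHomeomorph F N)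
    (hφ : ∀ x, x ∈ (φ x).source)
    (hcomp : ∀ x y, ContMDiffOn I I ∞ (φ y ∘ (φ x).symm) ((φ x).symm ≫ₕ φ y).source)
    (ψ : OpenPartialHomeomorph F N)
    (hψ : ∀ x, ContMDiffOn I I ∞ (ψ ∘ (φ x).symm) ((φ x).symm ≫ₕ ψ).source) :
    letI := chartedSpaceOfLocalHomeomorphs (H := H) φ hφ
    ContMDiffOn I I ∞ ψ ψ.source := by
  let _ := chartedSpaceOfLocalHomeomorphs (H := H) φ hφ
  have := isManifold_ofLocalHomeomorphs I φ hφ hcomp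
  intro x hx
  have h1 := contMDiffOn_chart_symm (I := I) (n := ∞) (x := φ x x)
  have h2 : ContMDiffOn I I ∞ (φ x ≫ₕ chartAt H (φ x x)) (φ x ≫ₕ chartAt H (φ x x)).source :=
    contMDiffOn_chart (I := I) (n := ∞) (x := x)
  have h3 := ((hψ x).comp' (h1.comp' h2)) x (by simp [hφ x, hx])
  have ho : IsOpen ((φ x ≫ₕ chartAt H (φ x x)).source ∩ ψ.source) :=
    (OpenPartialHomeomorph.open_source _).inter ψ.open_source
  have hxo : x ∈ (φ x ≫ₕ chartAt H (φ x x)).source ∩ ψ.source := by simp [hφ x, hx]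
  refine ContMDiffAt.contMDiffWithinAt (ContMDiffWithinAt.contMDiffAt
    (s := (φ x ≫ₕ chartAt H (φ x x)).source ∩ ψ.source) ?_ (ho.mem_nhds hxo))
  refine (h3.mono ?_).congr ?_ ?_
  · intro z hz
    simp only [mfld_simps] at hz ⊢
    simp [hz]
  · intro z hz
    simp only [mfld_simps] at hz ⊢
    simp [hz]
  · simp [hφ x]

/-- The inverse of a local homeomorphism which is compatible with all `φ x` is smooth for the
manifold structure defined by the `φ x`. -/
theorem contMDiffOn_symm_of_compatible (φ : F → OpenPartialHomeomorph F N)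
    (hφ : ∀ x, x ∈ (φ x).source)
    (hcomp : ∀ x y, ContMDiffOn I I ∞ (φ y ∘ (φ x).symm) ((φ x).symm ≫ₕ φ y).source)
    (ψ : OpenPartialHomeomorph F N)
    (hψ : ∀ x, ContMDiffOn I I ∞ (φ x ∘ ψ.symm) (ψ.symm ≫ₕ φ x).source) :
    letI := chartedSpaceOfLocalHomeomorphs (H := H) φ hφ
    ContMDiffOn I I ∞ ψ.symm ψ.target := by
  let _ := chartedSpaceOfLocalHomeomorphs (H := H) φ hφ
  have := isManifold_ofLocalHomeomorphs I φ hφ hcomp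
  intro n hn
  obtain ⟨x, hx⟩ : ∃ x, x = ψ.symm n := ⟨_, rfl⟩
  have h1 := contMDiffOn_chart (I := I) (n := ∞) (x := φ x x)
  have h2 : ContMDiffOn I I ∞ (φ x ≫ₕ chartAt H (φ x x)).symm (φ x ≫ₕ chartAt H (φ x x)).target :=
    contMDiffOn_chart_symm (I := I) (n := ∞) (x := x)
  have h3 := h2.comp' (h1.comp' (hψ x))
  have ho : IsOpen (ψ.symm ≫ₕ φ x ≫ₕ chartAt H (φ x x)).source :=
    OpenPartialHomeomorph.open_source _
  have hxo : n ∈ (ψ.symm ≫ₕ φ x ≫ₕ chartAt H (φ x x)).source := by simp [hφ x, hn, ← hx]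
  refine ContMDiffAt.contMDiffWithinAt (ContMDiffWithinAt.contMDiffAt
    (s := (ψ.symm ≫ₕ φ x ≫ₕ chartAt H (φ x x)).source) ?_ (ho.mem_nhds hxo))
  refine ((h3 n ?_).mono ?_).congr ?_ ?_
  · simp [hφ x, hn, ← hx]
  · intro z hz
    simp only [mfld_simps] at hz ⊢
    simp [hz]
  · intro z hz
    simp only [mfld_simps] at hz ⊢
    simp [hz]
  · simp [hφ x, ← hx]

end ManifoldFromLocalHomeomorphs

/-! ### Smooth trivialisations -/

section Trivializations

variable {E₁ H₁ E₂ H₂ E₃ H₃ : Type*}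
  [NormedAddCommGroup E₁] [NormedSpace ℝ E₁] [TopologicalSpace H₁]
  [NormedAddCommGroup E₂] [NormedSpace ℝ E₂] [TopologicalSpace H₂]
  [NormedAddCommGroup E₃] [NormedSpace ℝ E₃] [TopologicalSpace H₃]
  {I₁ : ModelWithCorners ℝ E₁ H₁} {I₂ : ModelWithCorners ℝ E₂ H₂} {I₃ : ModelWithCorners ℝ E₃ H₃}
  {X Y Z : Type*}
  [TopologicalSpace X] [ChartedSpace H₁ X]
  [TopologicalSpace Y] [ChartedSpace H₂ Y]
  [TopologicalSpace Z] [ChartedSpace H₃ Z]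
  {π : X → Y} {e : Bundle.Trivialization Z π}

theorem Bundle.Trivialization.symm_mem_source (e : Bundle.Trivialization Z π) {y : Y}
    (hy : y ∈ e.baseSet) (z : Z) : e.toOpenPartialHomeomorph.symm (y, z) ∈ e.source :=
  e.map_target (e.mem_target.2 hy)

theorem IsSmoothTrivialization.mdifferentiable (he : IsSmoothTrivialization I₁ I₂ I₃ e) :
    e.toOpenPartialHomeomorph.MDifferentiable I₁ (I₂.prod I₃) :=
  ⟨he.contMDiffOn.mdifferentiableOn (by simp), he.contMDiffOn_symm.mdifferentiableOn (by simp)⟩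

theorem IsSmoothTrivialization.contMDiffAt (he : IsSmoothTrivialization I₁ I₂ I₃ e) {x : X}
    (hx : x ∈ e.source) : ContMDiffAt I₁ (I₂.prod I₃) ∞ e x :=
  he.contMDiffOn.contMDiffAt (e.open_source.mem_nhds hx)

theorem IsSmoothTrivialization.contMDiffAt_symm (he : IsSmoothTrivialization I₁ I₂ I₃ e)
    {q : Y × Z} (hq : q.1 ∈ e.baseSet) :
    ContMDiffAt (I₂.prod I₃) I₁ ∞ e.toOpenPartialHomeomorph.symm q :=
  he.contMDiffOn_symm.contMDiffAt (e.open_target.mem_nhds (e.mem_target.2 hq))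

/-- The projection of a smooth trivialisation is, near each point, the smooth submersion `pr₁`
preceded by a diffeomorphism. -/
theorem isSurjectiveSubmersion_of_trivializations (hπ : Function.Surjective π)
    (h : ∀ y : Y, ∃ e : Bundle.Trivialization Z π,
      y ∈ e.baseSet ∧ IsSmoothTrivialization I₁ I₂ I₃ e) :
    IsSurjectiveSubmersion I₁ I₂ π := by
  have key (x : X) : ∃ e : Bundle.Trivialization Z π, x ∈ e.source ∧
      IsSmoothTrivialization I₁ I₂ I₃ e ∧ π =ᶠ[𝓝 x] Prod.fst ∘ e := by
    obtain ⟨e, hy, he⟩ := h (π x)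
    have hx := e.mem_source.2 hy
    exact ⟨e, hx, he, (e.coe_fst_eventuallyEq_proj hx).symm⟩
  refine ⟨fun x => ?_, hπ, fun x => ?_⟩
  · obtain ⟨e, hx, he, heq⟩ := key x
    exact (contMDiffAt_fst.comp x (he.contMDiffAt hx)).congr_of_eventuallyEq heq
  · obtain ⟨e, hx, he, heq⟩ := key x
    rw [heq.mfderiv_eq, mfderiv_comp x mdifferentiableAt_fst
      ((he.contMDiffAt hx).mdifferentiableAt (by simp)), mfderiv_fst]
    have h1 := he.mdifferentiable.mfderiv_surjective hx
    exact Prod.fst_surjective.comp h1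

end Trivializations

/-! ### Arrows and orbits -/

section Algebra

variable {EM EG : Type*}
  [NormedAddCommGroup EM] [NormedSpace ℝ EM] [NormedAddCommGroup EG] [NormedSpace ℝ EG]
  {M G : Type*} [TopologicalSpace M] [ChartedSpace EM M] [TopologicalSpace G] [ChartedSpace EG G]
  {𝒢 : LieGroupoid EM EG M G}

namespace LieGroupoid

theorem mul_inv_cancel_left {a b : G} (h : 𝒢.t a = 𝒢.t b) : 𝒢.mul a (𝒢.mul (𝒢.inv a) b) = b := by
  rw [← 𝒢.mul_assoc _ _ _ (𝒢.t_inv a).symm (by rw [𝒢.s_inv, h]), 𝒢.mul_inv, h, 𝒢.one_mul]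

theorem inv_mul_cancel_left {a g : G} (h : 𝒢.s a = 𝒢.t g) :
    𝒢.mul (𝒢.inv a) (𝒢.mul a g) = g := by
  rw [← 𝒢.mul_assoc _ _ _ (𝒢.s_inv a) h, 𝒢.inv_mul, h, 𝒢.one_mul]

theorem t_inv_mul {a b : G} (h : 𝒢.t a = 𝒢.t b) : 𝒢.t (𝒢.mul (𝒢.inv a) b) = 𝒢.s a := by
  rw [𝒢.t_mul _ _ (by rw [𝒢.s_inv, h]), 𝒢.t_inv]

theorem t_leftMul {β : M → G} (hβ : ∀ m, 𝒢.s (β m) = m) (g : G) :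
    𝒢.t (𝒢.leftMul β g) = 𝒢.shadowAct β (𝒢.t g) :=
  𝒢.t_mul _ _ (hβ _)

theorem contMDiffWithinAt_mul {E H X : Type*} [NormedAddCommGroup E] [NormedSpace ℝ E]
    [TopologicalSpace H] {I : ModelWithCorners ℝ E H} [TopologicalSpace X] [ChartedSpace H X]
    {a b : X → G} {s : Set X} {x : X} (ha : ContMDiffWithinAt I 𝓘(ℝ, EG) ∞ a s x)
    (hb : ContMDiffWithinAt I 𝓘(ℝ, EG) ∞ b s x) (hab : ∀ y ∈ s, 𝒢.s (a y) = 𝒢.t (b y))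
    (hx : x ∈ s) : ContMDiffWithinAt I 𝓘(ℝ, EG) ∞ (fun y => 𝒢.mul (a y) (b y)) s x :=
  ContMDiffWithinAt.comp x (f := fun y => (a y, b y)) (𝒢.contMDiffOn_mul (a x, b x) (hab x hx))
    (ha.prodMk hb) hab

end LieGroupoid

namespace RightModule

variable {EP : Type*} [NormedAddCommGroup EP] [NormedSpace ℝ EP]
  {P : Type*} [TopologicalSpace P] [ChartedSpace EP P] (X : RightModule 𝒢 (EP := EP) P)

/-- Two points are related if they lie in the same orbit of the action. -/
def orbitSetoid : Setoid P where
  r p q := ∃ g, X.μ p = 𝒢.t g ∧ X.act p g = q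
  iseqv := by
    refine ⟨fun p => ⟨_, (𝒢.t_one _).symm, X.act_one p⟩, ?_, ?_⟩
    · rintro p _ ⟨g, hg, rfl⟩
      refine ⟨𝒢.inv g, by rw [X.μ_act _ _ hg, 𝒢.t_inv], ?_⟩
      rw [X.act_act _ _ _ hg (𝒢.t_inv g).symm, 𝒢.mul_inv, ← hg, X.act_one]
    · rintro p _ _ ⟨g, hg, rfl⟩ ⟨h, hh, rfl⟩
      rw [X.μ_act _ _ hg] at hh
      exact ⟨𝒢.mul g h, by rw [𝒢.t_mul _ _ hh, hg], (X.act_act _ _ _ hg hh).symm⟩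

end RightModule

end Algebra

/-! ### Equivariant trivialisations -/

section Shadow

variable {EM EG EP ES : Type*}
  [NormedAddCommGroup EM] [NormedSpace ℝ EM] [NormedAddCommGroup EG] [NormedSpace ℝ EG]
  [NormedAddCommGroup EP] [NormedSpace ℝ EP] [NormedAddCommGroup ES] [NormedSpace ℝ ES]
  {M G P S : Type*} [TopologicalSpace M] [ChartedSpace EM M] [TopologicalSpace G]
  [ChartedSpace EG G] [TopologicalSpace P] [ChartedSpace EP P] [TopologicalSpace S]
  [ChartedSpace ES S] {𝒢 : LieGroupoid EM EG M G}

namespace IsEquivariantTrivialization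

variable {X : RightModule 𝒢 (EP := EP) P} {π : P → S} {e : Bundle.Trivialization G π}
  (he : IsEquivariantTrivialization X e)

include he

theorem μ_symm {σ : S} (hσ : σ ∈ e.baseSet) (g : G) :
    X.μ (e.toOpenPartialHomeomorph.symm (σ, g)) = 𝒢.s g := by
  have h := (he σ hσ g (𝒢.one (𝒢.s g))).1
  rw [𝒢.t_one] at h
  exact h.1 rfl

theorem s_snd {p : P} (hp : p ∈ e.source) : 𝒢.s (e p).2 = X.μ p := by
  rw [← he.μ_symm (e.mem_source.1 hp), e.symm_apply_mk_proj hp]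

theorem act_symm {σ : S} (hσ : σ ∈ e.baseSet) {g h : G} (hgh : 𝒢.s g = 𝒢.t h) :
    X.act (e.toOpenPartialHomeomorph.symm (σ, g)) h =
      e.toOpenPartialHomeomorph.symm (σ, 𝒢.mul g h) :=
  (he σ hσ g h).2 hgh

theorem act_eq {p : P} (hp : p ∈ e.source) {g : G} (hg : X.μ p = 𝒢.t g) :
    X.act p g = e.toOpenPartialHomeomorph.symm (π p, 𝒢.mul (e p).2 g) := by
  rw [← he.act_symm (e.mem_source.1 hp) ((he.s_snd hp).trans hg), e.symm_apply_mk_proj hp]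

theorem apply_act {p : P} (hp : p ∈ e.source) {g : G} (hg : X.μ p = 𝒢.t g) :
    e (X.act p g) = (π p, 𝒢.mul (e p).2 g) := by
  rw [he.act_eq hp hg, e.apply_symm_apply' (e.mem_source.1 hp)]

/-- In an equivariant trivialisation, `a⁻¹.b` carries `(σ, a)` to `(σ, b)` if `t a = t b`. -/
theorem act_inv_mul {p q : P} (hp : p ∈ e.source) (hq : q ∈ e.source) (hπ : π p = π q)
    (ht : 𝒢.t (e p).2 = 𝒢.t (e q).2) :
    X.μ p = 𝒢.t (𝒢.mul (𝒢.inv (e p).2) (e q).2) ∧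
      X.act p (𝒢.mul (𝒢.inv (e p).2) (e q).2) = q := by
  have h : X.μ p = 𝒢.t (𝒢.mul (𝒢.inv (e p).2) (e q).2) := by
    rw [LieGroupoid.t_inv_mul ht, he.s_snd hp]
  refine ⟨h, ?_⟩
  rw [he.act_eq hp h, LieGroupoid.mul_inv_cancel_left ht, hπ, e.symm_apply_mk_proj hq]

/-- The orbits are the fibres of `(σ, g) ↦ (σ, t g)`. -/
theorem orbit_iff {p q : P} (hp : p ∈ e.source) (hq : q ∈ e.source) :
    X.orbitSetoid p q ↔ π p = π q ∧ 𝒢.t (e p).2 = 𝒢.t (e q).2 := by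
  constructor
  · rintro ⟨g, hg, rfl⟩
    have h := he.apply_act hp hg
    rw [h, 𝒢.t_mul _ _ ((he.s_snd hp).trans hg), ← e.coe_fst hq, h]
    exact ⟨rfl, rfl⟩
  · rintro ⟨hπ, ht⟩
    exact ⟨_, he.act_inv_mul hp hq hπ ht⟩

theorem eq_inv_mul {p : P} (hp : p ∈ e.source) {g : G} (hg : X.μ p = 𝒢.t g) :
    g = 𝒢.mul (𝒢.inv (e p).2) (e (X.act p g)).2 := by
  rw [he.apply_act hp hg, LieGroupoid.inv_mul_cancel_left ((he.s_snd hp).trans hg)]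

end IsEquivariantTrivialization

/-- The section `(σ, m) ↦ (σ, 1_m)` of a smooth trivialisation is smooth. -/
theorem IsSmoothTrivialization.contMDiffAt_symm_one {π : P → S} {e : Bundle.Trivialization G π}
    (hs : IsSmoothTrivialization 𝓘(ℝ, EP) 𝓘(ℝ, ES) 𝓘(ℝ, EG) e) (𝒢 : LieGroupoid EM EG M G)
    {q : S × M} (hq : q.1 ∈ e.baseSet) :
    ContMDiffAt (𝓘(ℝ, ES).prod 𝓘(ℝ, EM)) 𝓘(ℝ, EP) ∞
      (fun q : S × M => e.toOpenPartialHomeomorph.symm (q.1, 𝒢.one q.2)) q := by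
  have h : ContMDiffAt (𝓘(ℝ, ES).prod 𝓘(ℝ, EM)) (𝓘(ℝ, ES).prod 𝓘(ℝ, EG)) ∞
      (fun q : S × M => (q.1, 𝒢.one q.2)) q :=
    contMDiffAt_fst.prodMk ((𝒢.contMDiff_one _).comp q contMDiffAt_snd)
  exact (hs.contMDiffAt_symm (q := (q.1, 𝒢.one q.2)) hq).comp q h

/-- The arrow by which the change of trivialisations moves the units, in dependence on the base
point and the unit, is smooth. -/
theorem IsSmoothTrivialization.contMDiffAt_transition_one {π : P → S}
    {e e' : Bundle.Trivialization G π}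
    (hs : IsSmoothTrivialization 𝓘(ℝ, EP) 𝓘(ℝ, ES) 𝓘(ℝ, EG) e)
    (hs' : IsSmoothTrivialization 𝓘(ℝ, EP) 𝓘(ℝ, ES) 𝓘(ℝ, EG) e') (𝒢 : LieGroupoid EM EG M G)
    {q : S × M} (hq : q.1 ∈ e.baseSet ∩ e'.baseSet) :
    ContMDiffAt (𝓘(ℝ, ES).prod 𝓘(ℝ, EM)) 𝓘(ℝ, EG) ∞
      (fun q : S × M => (e' (e.toOpenPartialHomeomorph.symm (q.1, 𝒢.one q.2))).2) q := by
  have hmem : e.toOpenPartialHomeomorph.symm (q.1, 𝒢.one q.2) ∈ e'.source := by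
    rw [e'.mem_source, e.proj_symm_apply' hq.1]
    exact hq.2
  exact contMDiffAt_snd.comp q ((hs'.contMDiffAt hmem).comp q (hs.contMDiffAt_symm_one 𝒢 hq.1))

/-! ### The shadow and the sitting-duck map -/

namespace PrincipaloidBundle

variable (Q : PrincipaloidBundle 𝒢 EP P ES S)

/-- The shadow of a principaloid bundle: the orbit space of the action on the total space, with the
quotient topology. -/
def Shadow : Type _ := Quotient Q.orbitSetoid

instance : TopologicalSpace Q.Shadow := inferInstanceAs (TopologicalSpace (Quotient Q.orbitSetoid))

/-- The sitting-duck map: the quotient map onto the orbit space. -/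
def sittingDuck (p : P) : Q.Shadow := Quotient.mk Q.orbitSetoid p

/-- The bundle projection of the shadow. -/
def shadowProj : Q.Shadow → S :=
  Quotient.lift Q.π (by
    rintro p _ ⟨g, hg, rfl⟩
    exact (Q.π_act p g hg).symm)

theorem isQuotientMap_sittingDuck : Topology.IsQuotientMap Q.sittingDuck := isQuotientMap_quot_mk

theorem sittingDuck_surjective : Function.Surjective Q.sittingDuck := Quotient.mk_surjective

@[simp]
theorem shadowProj_sittingDuck (p : P) : Q.shadowProj (Q.sittingDuck p) = Q.π p := rfl

theorem sittingDuck_eq_iff {p q : P} :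
    Q.sittingDuck p = Q.sittingDuck q ↔ ∃ g, Q.μ p = 𝒢.t g ∧ Q.act p g = q :=
  Quotient.eq (r := Q.orbitSetoid)

theorem continuous_shadowProj : Continuous Q.shadowProj :=
  Q.isQuotientMap_sittingDuck.continuous_iff.2 Q.submersion_π.contMDiff.continuous

theorem shadowProj_surjective : Function.Surjective Q.shadowProj := fun σ => by
  obtain ⟨p, rfl⟩ := Q.submersion_π.surjective σ
  exact ⟨Q.sittingDuck p, rfl⟩

variable {Q} {e e' : Bundle.Trivialization G Q.π}
  (he : IsEquivariantTrivialization Q.toRightModule e)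
  (he' : IsEquivariantTrivialization Q.toRightModule e')

include he in
theorem sittingDuck_symm_eq_iff {σ : S} (hσ : σ ∈ e.baseSet) {p : P} (hp : p ∈ e.source) {g : G} :
    Q.sittingDuck (e.toOpenPartialHomeomorph.symm (σ, g)) = Q.sittingDuck p ↔
      σ = Q.π p ∧ 𝒢.t g = 𝒢.t (e p).2 := by
  rw [sittingDuck_eq_iff]
  refine (he.orbit_iff (e.symm_mem_source hσ g) hp).trans ?_
  rw [e.proj_symm_apply' hσ, e.apply_symm_apply' hσ]

include he in
/-- The fibre coordinate `t (e p).2` depends only on the orbit of `p`. -/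
theorem t_snd_eq_of_sittingDuck_eq {p q : P} (hp : p ∈ e.source)
    (h : Q.sittingDuck p = Q.sittingDuck q) : 𝒢.t (e p).2 = 𝒢.t (e q).2 := by
  have hq : q ∈ e.source := by
    rw [e.mem_source, ← Q.shadowProj_sittingDuck, ← h]
    exact e.mem_source.1 hp
  exact ((he.orbit_iff hp hq).1 (Q.sittingDuck_eq_iff.1 h)).2

/-- The local trivialisation of the shadow induced by an equivariant trivialisation `e` of the
bundle: the orbit of `e⁻¹(σ, g)` goes to `(σ, t g)`, and `(σ, m)` comes from the orbit of
`e⁻¹(σ, 1_m)`. Points are mapped by means of arbitrary representatives. -/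
noncomputable def shadowTrivialization : Bundle.Trivialization M Q.shadowProj where
  toFun x := (Q.shadowProj x, 𝒢.t (e (Q.sittingDuck_surjective x).choose).2)
  invFun q := Q.sittingDuck (e.toOpenPartialHomeomorph.symm (q.1, 𝒢.one q.2))
  source := Q.shadowProj ⁻¹' e.baseSet
  target := e.baseSet ×ˢ univ
  map_source' x hx := ⟨hx, mem_univ _⟩
  map_target' q hq := by
    simpa [e.proj_symm_apply' hq.1] using hq.1
  left_inv' x hx := by
    have hp := (Q.sittingDuck_surjective x).choose_spec
    refine Eq.trans ((sittingDuck_symm_eq_iff he hx ?_).2 ⟨?_, 𝒢.t_one _⟩) hp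
    · rw [e.mem_source, ← Q.shadowProj_sittingDuck, hp]
      exact hx
    · rw [← Q.shadowProj_sittingDuck, hp]
  right_inv' q hq := by
    have hp := (Q.sittingDuck_surjective
      (Q.sittingDuck (e.toOpenPartialHomeomorph.symm (q.1, 𝒢.one q.2)))).choose_spec
    have h := t_snd_eq_of_sittingDuck_eq he (e.symm_mem_source hq.1 _) hp.symm
    refine Prod.ext (by simp [e.proj_symm_apply' hq.1]) ?_
    refine h.symm.trans ?_
    rw [e.apply_symm_apply' hq.1, 𝒢.t_one]
  open_source := e.open_baseSet.preimage Q.continuous_shadowProj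
  open_target := e.open_baseSet.prod isOpen_univ
  continuousOn_toFun := by
    rw [Q.isQuotientMap_sittingDuck.continuousOn_isOpen_iff
      (e.open_baseSet.preimage Q.continuous_shadowProj)]
    have h : ContinuousOn (fun p => (Q.π p, 𝒢.t (e p).2)) e.source :=
      Q.submersion_π.contMDiff.continuous.continuousOn.prodMk
        (𝒢.submersion_t.contMDiff.continuous.comp_continuousOn
          (continuous_snd.comp_continuousOn e.toOpenPartialHomeomorph.continuousOn))
    rw [← preimage_comp, show Q.shadowProj ∘ Q.sittingDuck = Q.π from rfl, ← e.source_eq]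
    refine h.congr fun p hp => Prod.ext rfl ?_
    exact (t_snd_eq_of_sittingDuck_eq he hp
      (Q.sittingDuck_surjective (Q.sittingDuck p)).choose_spec.symm).symm
  continuousOn_invFun := by
    refine Q.isQuotientMap_sittingDuck.continuous.comp_continuousOn
      (e.toOpenPartialHomeomorph.continuousOn_symm.comp (Continuous.continuousOn ?_) ?_)
    · exact continuous_fst.prodMk (𝒢.contMDiff_one.continuous.comp continuous_snd)
    · exact fun q hq => e.mem_target.2 hq.1
  baseSet := e.baseSet
  open_baseSet := e.open_baseSet
  source_eq := rfl
  target_eq := rfl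
  proj_toFun _ _ := rfl

theorem shadowTrivialization_sittingDuck {p : P} (hp : p ∈ e.source) :
    shadowTrivialization he (Q.sittingDuck p) = (Q.π p, 𝒢.t (e p).2) :=
  Prod.ext rfl (t_snd_eq_of_sittingDuck_eq he hp
    (Q.sittingDuck_surjective (Q.sittingDuck p)).choose_spec.symm).symm

theorem shadowTrivialization_symm_apply (q : S × M) :
    (shadowTrivialization he).toOpenPartialHomeomorph.symm q =
      Q.sittingDuck (e.toOpenPartialHomeomorph.symm (q.1, 𝒢.one q.2)) := rfl

theorem sittingDuck_symm {σ : S} (hσ : σ ∈ e.baseSet) (g : G) :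
    Q.sittingDuck (e.toOpenPartialHomeomorph.symm (σ, g)) =
      (shadowTrivialization he).toOpenPartialHomeomorph.symm (σ, 𝒢.t g) := by
  rw [shadowTrivialization_symm_apply]
  refine (sittingDuck_symm_eq_iff he hσ (e.symm_mem_source hσ _)).2 ?_
  rw [e.proj_symm_apply' hσ, e.apply_symm_apply' hσ, 𝒢.t_one]
  exact ⟨rfl, rfl⟩

theorem shadowTrivialization_transition {σ : S} (hσ : σ ∈ e.baseSet ∩ e'.baseSet) (m : M) :
    shadowTrivialization he' ((shadowTrivialization he).toOpenPartialHomeomorph.symm (σ, m)) =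
      (σ, 𝒢.t (e' (e.toOpenPartialHomeomorph.symm (σ, 𝒢.one m))).2) := by
  have h := e.proj_symm_apply' (x := 𝒢.one m) hσ.1
  rw [shadowTrivialization_symm_apply, shadowTrivialization_sittingDuck, h]
  rw [e'.mem_source, h]
  exact hσ.2

theorem contMDiffOn_shadowTrivialization_transition
    (hs : IsSmoothTrivialization 𝓘(ℝ, EP) 𝓘(ℝ, ES) 𝓘(ℝ, EG) e)
    (hs' : IsSmoothTrivialization 𝓘(ℝ, EP) 𝓘(ℝ, ES) 𝓘(ℝ, EG) e') :
    ContMDiffOn (𝓘(ℝ, ES).prod 𝓘(ℝ, EM)) (𝓘(ℝ, ES).prod 𝓘(ℝ, EM)) ∞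
      ((shadowTrivialization he').toOpenPartialHomeomorph ∘
        (shadowTrivialization he).toOpenPartialHomeomorph.symm)
      ((shadowTrivialization he).toOpenPartialHomeomorph.symm ≫ₕ
        (shadowTrivialization he').toOpenPartialHomeomorph).source := by
  have hsource : ((shadowTrivialization he).toOpenPartialHomeomorph.symm ≫ₕ
      (shadowTrivialization he').toOpenPartialHomeomorph).source =
      (e.baseSet ∩ e'.baseSet) ×ˢ univ := Bundle.Trivialization.symm_trans_source_eq _ _
  rw [hsource]
  have h : ContMDiffOn (𝓘(ℝ, ES).prod 𝓘(ℝ, EM)) (𝓘(ℝ, ES).prod 𝓘(ℝ, EM)) ∞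
      (fun q : S × M => (q.1, 𝒢.t (e' (e.toOpenPartialHomeomorph.symm (q.1, 𝒢.one q.2))).2))
      ((e.baseSet ∩ e'.baseSet) ×ˢ univ) := fun q hq =>
    (contMDiffAt_fst.prodMk ((𝒢.submersion_t.contMDiff _).comp q
      (hs.contMDiffAt_transition_one hs' 𝒢 hq.1))).contMDiffWithinAt
  exact h.congr fun q hq => shadowTrivialization_transition he he' hq.1 q.2

/-! ### The manifold structure of the shadow -/

variable (Q)

/-- A chosen equivariant trivialisation around a point of the base. -/
noncomputable def localTrivialization (σ : S) : Bundle.Trivialization G Q.π :=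
  (Q.locallyTrivial σ).choose

theorem mem_baseSet_localTrivialization (σ : S) : σ ∈ (Q.localTrivialization σ).baseSet :=
  (Q.locallyTrivial σ).choose_spec.1

theorem localTrivialization_smooth (σ : S) :
    IsSmoothTrivialization 𝓘(ℝ, EP) 𝓘(ℝ, ES) 𝓘(ℝ, EG) (Q.localTrivialization σ) :=
  (Q.locallyTrivial σ).choose_spec.2.1

theorem localTrivialization_equivariant (σ : S) :
    IsEquivariantTrivialization Q.toRightModule (Q.localTrivialization σ) :=
  (Q.locallyTrivial σ).choose_spec.2.2

/-- The local homeomorphisms into `S × M` which define the smooth structure of the shadow. -/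
noncomputable def shadowLocalHomeomorph (x : Q.Shadow) : OpenPartialHomeomorph Q.Shadow (S × M) :=
  (shadowTrivialization (Q.localTrivialization_equivariant (Q.shadowProj x))).toOpenPartialHomeomorph

theorem mem_source_shadowLocalHomeomorph (x : Q.Shadow) :
    x ∈ (Q.shadowLocalHomeomorph x).source :=
  (Bundle.Trivialization.mem_source _).2 (Q.mem_baseSet_localTrivialization _)

theorem contMDiffOn_shadowLocalHomeomorph (x y : Q.Shadow) :
    ContMDiffOn (𝓘(ℝ, ES).prod 𝓘(ℝ, EM)) (𝓘(ℝ, ES).prod 𝓘(ℝ, EM)) ∞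
      (Q.shadowLocalHomeomorph y ∘ (Q.shadowLocalHomeomorph x).symm)
      ((Q.shadowLocalHomeomorph x).symm ≫ₕ Q.shadowLocalHomeomorph y).source :=
  contMDiffOn_shadowTrivialization_transition _ _ (Q.localTrivialization_smooth _)
    (Q.localTrivialization_smooth _)

noncomputable instance : ChartedSpace (ModelProd ES EM) Q.Shadow :=
  chartedSpaceOfLocalHomeomorphs Q.shadowLocalHomeomorph Q.mem_source_shadowLocalHomeomorph

instance [T2Space M] [T2Space S] : T2Space Q.Shadow := by
  refine ⟨fun x y hxy => ?_⟩
  by_cases h : Q.shadowProj x = Q.shadowProj y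
  · have hx := Q.mem_source_shadowLocalHomeomorph x
    have hy : y ∈ (Q.shadowLocalHomeomorph x).source := by
      refine (Bundle.Trivialization.mem_source _).2 ?_
      rw [← h]
      exact Q.mem_baseSet_localTrivialization _
    obtain ⟨u, v, hu, hv, hxu, hyv, huv⟩ := t2_separation
      (fun hφ => hxy ((Q.shadowLocalHomeomorph x).injOn hx hy hφ))
    exact ⟨_, _, (Q.shadowLocalHomeomorph x).isOpen_inter_preimage hu,
      (Q.shadowLocalHomeomorph x).isOpen_inter_preimage hv, ⟨hx, hxu⟩, ⟨hy, hyv⟩,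
      (huv.preimage _).mono inter_subset_right inter_subset_right⟩
  · exact separated_by_continuous Q.continuous_shadowProj h

theorem secondCountableTopology_shadow [FiniteDimensional ℝ EM] [FiniteDimensional ℝ ES]
    [FiniteDimensional ℝ EP] [SecondCountableTopology P] :
    SecondCountableTopology Q.Shadow := by
  have : LocallyCompactSpace P := ChartedSpace.locallyCompactSpace EP P
  have hσ : IsSigmaCompact (range Q.sittingDuck) :=
    isSigmaCompact_range Q.isQuotientMap_sittingDuck.continuous
  rw [Q.sittingDuck_surjective.range_eq, isSigmaCompact_univ_iff] at hσ
  have : SecondCountableTopology (ModelProd ES EM) :=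
    inferInstanceAs (SecondCountableTopology (ES × EM))
  exact ChartedSpace.secondCountable_of_sigmaCompact (ModelProd ES EM) Q.Shadow

section

variable [IsManifold 𝓘(ℝ, EM) ∞ M] [IsManifold 𝓘(ℝ, ES) ∞ S]

instance : IsManifold (𝓘(ℝ, ES).prod 𝓘(ℝ, EM)) ∞ Q.Shadow :=
  isManifold_ofLocalHomeomorphs _ _ Q.mem_source_shadowLocalHomeomorph
    Q.contMDiffOn_shadowLocalHomeomorph

variable {Q}

theorem shadowTrivialization_smooth
    (hs : IsSmoothTrivialization 𝓘(ℝ, EP) 𝓘(ℝ, ES) 𝓘(ℝ, EG) e) :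
    IsSmoothTrivialization (𝓘(ℝ, ES).prod 𝓘(ℝ, EM)) 𝓘(ℝ, ES) 𝓘(ℝ, EM)
      (shadowTrivialization he) where
  contMDiffOn := contMDiffOn_of_compatible _ _ Q.mem_source_shadowLocalHomeomorph
    Q.contMDiffOn_shadowLocalHomeomorph _ fun _ =>
      contMDiffOn_shadowTrivialization_transition _ _ (Q.localTrivialization_smooth _) hs
  contMDiffOn_symm := contMDiffOn_symm_of_compatible _ _ Q.mem_source_shadowLocalHomeomorph
    Q.contMDiffOn_shadowLocalHomeomorph _ fun _ =>
      contMDiffOn_shadowTrivialization_transition _ _ hs (Q.localTrivialization_smooth _)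

variable (Q)

theorem isSmoothFibreBundle_shadowProj :
    IsSmoothFibreBundle (𝓘(ℝ, ES).prod 𝓘(ℝ, EM)) 𝓘(ℝ, ES) 𝓘(ℝ, EM) M Q.shadowProj := by
  have h (σ : S) : ∃ e : Bundle.Trivialization M Q.shadowProj, σ ∈ e.baseSet ∧
      IsSmoothTrivialization (𝓘(ℝ, ES).prod 𝓘(ℝ, EM)) 𝓘(ℝ, ES) 𝓘(ℝ, EM) e :=
    ⟨shadowTrivialization (Q.localTrivialization_equivariant σ),
      Q.mem_baseSet_localTrivialization σ,
      shadowTrivialization_smooth _ (Q.localTrivialization_smooth σ)⟩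
  exact ⟨isSurjectiveSubmersion_of_trivializations Q.shadowProj_surjective h, h⟩

end

end PrincipaloidBundle

end Shadow

section Main

variable {EM EG EP ES : Type*}
  [NormedAddCommGroup EM] [NormedSpace ℝ EM] [NormedAddCommGroup EG] [NormedSpace ℝ EG]
  [NormedAddCommGroup EP] [NormedSpace ℝ EP] [NormedAddCommGroup ES] [NormedSpace ℝ ES]
  {M G P S : Type*} [TopologicalSpace M] [ChartedSpace EM M] [TopologicalSpace G]
  [ChartedSpace EG G] [TopologicalSpace P] [ChartedSpace EP P] [TopologicalSpace S]
  [ChartedSpace ES S] {𝒢 : LieGroupoid EM EG M G}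

/-! ### The transition cocycle -/

section Transition

variable {X : RightModule 𝒢 (EP := EP) P} {π : P → S} {e e' e'' : Bundle.Trivialization G π}

variable (𝒢) in
/-- The arrows `(e' ∘ e⁻¹)(σ, 1_m)`, which form the bisection by which `e' ∘ e⁻¹` acts over `σ`. -/
def transitionArrow (e e' : Bundle.Trivialization G π) (σ : S) (m : M) : G :=
  (e' (e.toOpenPartialHomeomorph.symm (σ, 𝒢.one m))).2

theorem symm_mem_source_of_mem_inter {σ : S} (hσ : σ ∈ e.baseSet ∩ e'.baseSet) (g : G) :
    e.toOpenPartialHomeomorph.symm (σ, g) ∈ e'.source := by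
  rw [e'.mem_source, e.proj_symm_apply' hσ.1]
  exact hσ.2

theorem apply_symm_eq_mk {σ : S} (hσ : σ ∈ e.baseSet ∩ e'.baseSet) (g : G) :
    e' (e.toOpenPartialHomeomorph.symm (σ, g)) =
      (σ, (e' (e.toOpenPartialHomeomorph.symm (σ, g))).2) := by
  rw [← e'.mk_proj_snd (symm_mem_source_of_mem_inter hσ g), e.proj_symm_apply' hσ.1]

theorem s_transitionArrow (he : IsEquivariantTrivialization X e)
    (he' : IsEquivariantTrivialization X e') {σ : S} (hσ : σ ∈ e.baseSet ∩ e'.baseSet) (m : M) :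
    𝒢.s (transitionArrow 𝒢 e e' σ m) = m := by
  rw [transitionArrow, he'.s_snd (symm_mem_source_of_mem_inter hσ _), he.μ_symm hσ.1, 𝒢.s_one]

/-- An equivariant map is determined by its values on units, as `g = 1_{t g}.g`. -/
theorem transition_eq_leftMul (he : IsEquivariantTrivialization X e)
    (he' : IsEquivariantTrivialization X e') {σ : S} (hσ : σ ∈ e.baseSet ∩ e'.baseSet) (g : G) :
    e' (e.toOpenPartialHomeomorph.symm (σ, g)) =
      (σ, 𝒢.leftMul (transitionArrow 𝒢 e e' σ) g) := by
  have h := he.act_symm hσ.1 (𝒢.s_one (𝒢.t g))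
  rw [𝒢.one_mul] at h
  rw [← h, he'.apply_act (symm_mem_source_of_mem_inter hσ _)
    (by rw [he.μ_symm hσ.1, 𝒢.s_one]), e.proj_symm_apply' hσ.1]
  rfl

theorem bisectionMul_transitionArrow (he' : IsEquivariantTrivialization X e')
    (he'' : IsEquivariantTrivialization X e'') {σ : S} (h : σ ∈ e.baseSet) (h' : σ ∈ e'.baseSet)
    (h'' : σ ∈ e''.baseSet) :
    𝒢.bisectionMul (transitionArrow 𝒢 e' e'' σ) (transitionArrow 𝒢 e e' σ) =
      transitionArrow 𝒢 e e'' σ := by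
  funext m
  have h1 := transition_eq_leftMul he' he'' ⟨h', h''⟩ (transitionArrow 𝒢 e e' σ m)
  have h2 : e'.toOpenPartialHomeomorph.symm (σ, transitionArrow 𝒢 e e' σ m) =
      e.toOpenPartialHomeomorph.symm (σ, 𝒢.one m) := by
    rw [transitionArrow, ← apply_symm_eq_mk ⟨h, h'⟩]
    exact e'.toOpenPartialHomeomorph.left_inv (symm_mem_source_of_mem_inter ⟨h, h'⟩ _)
  rw [h2] at h1
  exact (congrArg Prod.snd h1).symm

/-- The shadow actions of the two opposite changes of trivialisations are mutually inverse. -/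
theorem shadowAct_transitionArrow_leftInverse (he : IsEquivariantTrivialization X e)
    (he' : IsEquivariantTrivialization X e') {σ : S} (hσ : σ ∈ e.baseSet ∩ e'.baseSet) (m : M) :
    𝒢.t (transitionArrow 𝒢 e' e σ (𝒢.t (transitionArrow 𝒢 e e' σ m))) = m := by
  have h := congrFun (bisectionMul_transitionArrow (e := e) he' he hσ.1 hσ.2 hσ.1) m
  have h' : 𝒢.t (transitionArrow 𝒢 e e σ m) = m := by
    rw [transitionArrow, e.apply_symm_apply' hσ.1, 𝒢.t_one]
  rw [← h, LieGroupoid.bisectionMul, 𝒢.t_mul _ _ (s_transitionArrow he' he hσ.symm _)] at h'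
  exact h'

theorem contMDiff_transitionArrow (hs : IsSmoothTrivialization 𝓘(ℝ, EP) 𝓘(ℝ, ES) 𝓘(ℝ, EG) e)
    (hs' : IsSmoothTrivialization 𝓘(ℝ, EP) 𝓘(ℝ, ES) 𝓘(ℝ, EG) e') {σ : S}
    (hσ : σ ∈ e.baseSet ∩ e'.baseSet) :
    ContMDiff 𝓘(ℝ, EM) 𝓘(ℝ, EG) ∞ (transitionArrow 𝒢 e e' σ) := fun m =>
  ContMDiffAt.comp m (f := fun m : M => (σ, m))
    (hs.contMDiffAt_transition_one hs' 𝒢 (q := (σ, m)) hσ)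
    (contMDiffAt_const.prodMk contMDiffAt_id)

theorem isBisection_transitionArrow (he : IsEquivariantTrivialization X e)
    (he' : IsEquivariantTrivialization X e')
    (hs : IsSmoothTrivialization 𝓘(ℝ, EP) 𝓘(ℝ, ES) 𝓘(ℝ, EG) e)
    (hs' : IsSmoothTrivialization 𝓘(ℝ, EP) 𝓘(ℝ, ES) 𝓘(ℝ, EG) e') {σ : S}
    (hσ : σ ∈ e.baseSet ∩ e'.baseSet) : 𝒢.IsBisection (transitionArrow 𝒢 e e' σ) where
  contMDiff := contMDiff_transitionArrow hs hs' hσ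
  s_apply := s_transitionArrow he he' hσ
  diffeo := ⟨
    { toFun m := 𝒢.t (transitionArrow 𝒢 e e' σ m)
      invFun m := 𝒢.t (transitionArrow 𝒢 e' e σ m)
      left_inv := shadowAct_transitionArrow_leftInverse he he' hσ
      right_inv := shadowAct_transitionArrow_leftInverse he' he hσ.symm
      contMDiff_toFun :=
        𝒢.submersion_t.contMDiff.comp (contMDiff_transitionArrow hs hs' hσ)
      contMDiff_invFun :=
        𝒢.submersion_t.contMDiff.comp (contMDiff_transitionArrow hs' hs hσ.symm) },
    fun _ => rfl⟩

end Transition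

namespace PrincipaloidBundle

variable {Q : PrincipaloidBundle 𝒢 EP P ES S}

section Family

variable {ι : Type*} {e : ι → Bundle.Trivialization G Q.π}

theorem IsTrivializingFamily.isTransitionCocycle (h : Q.IsTrivializingFamily e) :
    Q.IsTransitionCocycle e fun i j => transitionArrow 𝒢 (e j) (e i) where
  bisection i j _ hσ := isBisection_transitionArrow (h.equivariant j) (h.equivariant i)
    (h.smooth j) (h.smooth i) hσ.symm
  smooth i j _ hq :=
    ((h.smooth j).contMDiffAt_transition_one (h.smooth i) 𝒢 hq.1.symm).contMDiffWithinAt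
  transition i j _ hσ := transition_eq_leftMul (h.equivariant j) (h.equivariant i) hσ.symm
  cocycle i j _ _ hσ := bisectionMul_transitionArrow (h.equivariant j) (h.equivariant i)
    hσ.2 hσ.1.2 hσ.1.1

variable {β : ι → ι → S → M → G}

theorem IsTransitionCocycle.shadowTrivialization_transition (hβ : Q.IsTransitionCocycle e β)
    (he : ∀ i, IsEquivariantTrivialization Q.toRightModule (e i)) {i j : ι} {σ : S}
    (hσ : σ ∈ (e i).baseSet ∩ (e j).baseSet) (m : M) :
    shadowTrivialization (he i)
      ((shadowTrivialization (he j)).toOpenPartialHomeomorph.symm (σ, m)) =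
        (σ, 𝒢.shadowAct (β i j σ) m) := by
  rw [PrincipaloidBundle.shadowTrivialization_transition _ _ hσ.symm, hβ.transition i j σ hσ,
    LieGroupoid.t_leftMul (hβ.bisection i j σ hσ).s_apply, 𝒢.t_one]

/-- A bundle with local trivialisations over an open cover is the quotient of the disjoint union of
the pieces `O_i × M` by the transition maps. The map from the quotient is open since each piece is
embedded onto an open set. -/
theorem exists_gluedShadow_homeomorph {F : Type*} [TopologicalSpace F] {πF : F → S}
    (cover : ∀ σ : S, ∃ i, σ ∈ (e i).baseSet) (τ : ι → Bundle.Trivialization M πF)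
    (hb : ∀ i, (τ i).baseSet = (e i).baseSet)
    (hτ : ∀ i j, ∀ σ ∈ (e i).baseSet ∩ (e j).baseSet, ∀ m : M,
      τ i ((τ j).toOpenPartialHomeomorph.symm (σ, m)) = (σ, 𝒢.shadowAct (β i j σ) m)) :
    ∃ Ψ : Q.GluedShadow e β ≃ₜ F, ∀ (i : ι) (σ : (e i).baseSet) (m : M),
      Ψ (Quot.mk _ ⟨i, (σ, m)⟩) = (τ i).toOpenPartialHomeomorph.symm ((σ : S), m) := by
  let f : (Σ i : ι, (e i).baseSet × M) → F := fun x =>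
    (τ x.1).toOpenPartialHomeomorph.symm ((x.2.1 : S), x.2.2)
  have hmem (i : ι) (σ : (e i).baseSet) : (σ : S) ∈ (τ i).baseSet := (hb i).symm ▸ σ.2
  have hproj (x) : πF (f x) = x.2.1 := (τ x.1).proj_symm_apply' (hmem _ _)
  have hrel (x y) : Q.gluingRel e β x y ↔ f x = f y := by
    obtain ⟨i, ⟨σ, hσ⟩, m⟩ := x
    obtain ⟨j, ⟨σ', hσ'⟩, m'⟩ := y
    have hbase : f ⟨i, ⟨σ, hσ⟩, m⟩ = f ⟨j, ⟨σ', hσ'⟩, m'⟩ → σ = σ' := fun h => by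
      simpa [hproj] using congrArg πF h
    suffices σ = σ' → (m' = 𝒢.shadowAct (β j i σ) m ↔
        f ⟨i, ⟨σ, hσ⟩, m⟩ = f ⟨j, ⟨σ', hσ'⟩, m'⟩) from
      ⟨fun h => (this h.1).1 h.2, fun h => ⟨hbase h, (this (hbase h)).2 h⟩⟩
    rintro rfl
    have h := hτ j i σ ⟨hσ', hσ⟩ m
    have h1 : (τ i).toOpenPartialHomeomorph.symm (σ, m) ∈ (τ j).source := by
      rw [(τ j).mem_source, (τ i).proj_symm_apply' (hmem i ⟨σ, hσ⟩)]
      exact hmem j ⟨σ, hσ'⟩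
    have h2 := (τ j).toOpenPartialHomeomorph.left_inv h1
    constructor
    · rintro rfl
      change _ = (τ j).toOpenPartialHomeomorph.symm (σ, 𝒢.shadowAct (β j i σ) m)
      rw [← h]
      exact h2.symm
    · intro hf
      change _ = (τ j).toOpenPartialHomeomorph.symm (σ, m') at hf
      change (τ i).toOpenPartialHomeomorph.symm (σ, m) = _ at hf
      rw [hf, (τ j).apply_symm_apply' (hmem j ⟨σ, hσ'⟩)] at h
      exact congrArg Prod.snd h
  have hcont : Continuous f := by
    refine continuous_sigma fun i => ?_
    refine (τ i).toOpenPartialHomeomorph.continuousOn_symm.comp_continuous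
      ((continuous_subtype_val.comp continuous_fst).prodMk continuous_snd) fun x => ?_
    exact (τ i).mem_target.2 (hmem i x.1)
  have hopen : IsOpenMap f := by
    refine isOpenMap_sigma.2 fun i U hU => ?_
    have hval : IsOpenMap fun x : (e i).baseSet × M => ((x.1 : S), x.2) :=
      (e i).open_baseSet.isOpenMap_subtype_val.prodMap IsOpenMap.id
    have hsub : (fun x : (e i).baseSet × M => ((x.1 : S), x.2)) '' U ⊆ (τ i).target := by
      rintro _ ⟨x, -, rfl⟩
      exact (τ i).mem_target.2 (hmem i x.1)
    have := (τ i).toOpenPartialHomeomorph.symm.isOpen_image_of_subset_source (hval U hU) hsub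
    rwa [image_image] at this
  let Ψ : Q.GluedShadow e β → F := Quot.lift f fun x y h => (hrel x y).1 h
  have hbij : Function.Bijective Ψ := by
    constructor
    · rintro ⟨x⟩ ⟨y⟩ h
      exact Quot.sound ((hrel x y).2 h)
    · intro z
      obtain ⟨i, hi⟩ := cover (πF z)
      refine ⟨Quot.mk _ ⟨i, ⟨πF z, hi⟩, (τ i z).2⟩, ?_⟩
      exact (τ i).symm_apply_mk_proj ((τ i).mem_source.2 (hmem i ⟨_, hi⟩))
  have hΨ : IsOpenMap Ψ := fun U hU => by
    have h : Ψ '' U = f '' (Quot.mk _ ⁻¹' U) := by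
      conv_lhs => rw [← image_preimage_eq U Quot.mk_surjective, image_image]
    rw [h]
    exact hopen _ (hU.preimage continuous_quot_mk)
  exact ⟨(Equiv.ofBijective Ψ hbij).toHomeomorphOfContinuousOpen (continuous_quot_lift _ hcont) hΨ,
    fun _ _ _ => rfl⟩

variable [IsManifold 𝓘(ℝ, EM) ∞ M] [IsManifold 𝓘(ℝ, ES) ∞ S]

theorem isShadow_sittingDuck (h : Q.IsTrivializingFamily e) (hβ : Q.IsTransitionCocycle e β) :
    Q.IsShadow e β Q.shadowProj Q.sittingDuck :=
  ⟨fun i => shadowTrivialization (h.equivariant i), fun _ => rfl,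
    fun i => shadowTrivialization_smooth _ (h.smooth i),
    fun _ _ _ hσ => hβ.shadowTrivialization_transition h.equivariant hσ,
    exists_gluedShadow_homeomorph h.cover _ (fun _ => rfl)
      fun _ _ _ hσ => hβ.shadowTrivialization_transition h.equivariant hσ,
    fun i _ hσ => sittingDuck_symm (h.equivariant i) hσ⟩

end Family

/-! ### The principal bundle over the shadow -/

variable (Q)

theorem isSurjectiveSubmersion_sittingDuck [IsManifold 𝓘(ℝ, EM) ∞ M]
    [IsManifold 𝓘(ℝ, ES) ∞ S] :
    IsSurjectiveSubmersion 𝓘(ℝ, EP) (𝓘(ℝ, ES).prod 𝓘(ℝ, EM)) Q.sittingDuck := by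
  have key (p : P) : ∃ (e : Bundle.Trivialization G Q.π) (τ : Bundle.Trivialization M Q.shadowProj),
      p ∈ e.source ∧ Q.π p ∈ τ.baseSet ∧
      IsSmoothTrivialization 𝓘(ℝ, EP) 𝓘(ℝ, ES) 𝓘(ℝ, EG) e ∧
      IsSmoothTrivialization (𝓘(ℝ, ES).prod 𝓘(ℝ, EM)) 𝓘(ℝ, ES) 𝓘(ℝ, EM) τ ∧
      Q.sittingDuck =ᶠ[𝓝 p] τ.toOpenPartialHomeomorph.symm ∘ Prod.map id 𝒢.t ∘ e := by
    obtain ⟨e, hp, hs, he⟩ := Q.locallyTrivial (Q.π p)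
    refine ⟨e, shadowTrivialization he, e.mem_source.2 hp, hp, hs, shadowTrivialization_smooth he hs,
      Filter.eventuallyEq_of_mem (e.open_source.mem_nhds (e.mem_source.2 hp)) fun q hq => ?_⟩
    have h := sittingDuck_symm he (e.mem_source.1 hq) (e q).2
    rw [e.symm_apply_mk_proj hq] at h
    rw [h, ← e.coe_fst hq]
    rfl
  have ht : ContMDiff (𝓘(ℝ, ES).prod 𝓘(ℝ, EG)) (𝓘(ℝ, ES).prod 𝓘(ℝ, EM)) ∞
      (Prod.map (id : S → S) 𝒢.t) := contMDiff_id.prodMap 𝒢.submersion_t.contMDiff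
  refine ⟨fun p => ?_, Q.sittingDuck_surjective, fun p => ?_⟩
  · obtain ⟨e, τ, hp, hτ, hs, hsτ, heq⟩ := key p
    refine ContMDiffAt.congr_of_eventuallyEq ?_ heq
    refine ContMDiffAt.comp p (hsτ.contMDiffAt_symm ?_) ((ht _).comp p (hs.contMDiffAt hp))
    simpa [e.coe_fst hp] using hτ
  · obtain ⟨e, τ, hp, hτ, hs, hsτ, heq⟩ := key p
    have hq : (Prod.map id 𝒢.t ∘ e) p ∈ τ.target := by
      rw [τ.mem_target]
      simpa [e.coe_fst hp] using hτ
    have h1 := (hs.contMDiffAt hp).mdifferentiableAt (by simp)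
    have h2 := (ht (e p)).mdifferentiableAt (by simp)
    rw [heq.mfderiv_eq, mfderiv_comp p
      (hsτ.mdifferentiable.mdifferentiableAt_symm hq) (h2.comp p h1), mfderiv_comp p h2 h1]
    have h3 : Function.Surjective (mfderiv (𝓘(ℝ, ES).prod 𝓘(ℝ, EG)) (𝓘(ℝ, ES).prod 𝓘(ℝ, EM))
        (Prod.map (id : S → S) 𝒢.t) (e p)) := by
      rw [mfderiv_prodMap mdifferentiableAt_id
        ((𝒢.submersion_t.contMDiff _).mdifferentiableAt (by simp)), mfderiv_id]
      exact Function.surjective_id.prodMap (𝒢.submersion_t.mfderiv_surjective _)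
    exact (hsτ.mdifferentiable.symm.mfderiv_surjective hq).comp
      (h3.comp (hs.mdifferentiable.mfderiv_surjective hp))

/-- The division map: `((σ, a), (σ, b)) ↦ a⁻¹.b` in a trivialisation chosen around the base point of
the first argument. Its value off `P ×_F P` has no meaning. -/
noncomputable def division (q : P × P) : G :=
  𝒢.mul (𝒢.inv (Q.localTrivialization (Q.π q.1) q.1).2) (Q.localTrivialization (Q.π q.1) q.2).2

/-- Uniqueness of division makes the chosen trivialisation irrelevant. -/
theorem division_act {p : P} {g : G} (hg : Q.μ p = 𝒢.t g) : Q.division (p, Q.act p g) = g :=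
  ((Q.localTrivialization_equivariant (Q.π p)).eq_inv_mul
    ((Bundle.Trivialization.mem_source _).2 (Q.mem_baseSet_localTrivialization _)) hg).symm

theorem division_eq {e : Bundle.Trivialization G Q.π}
    (he : IsEquivariantTrivialization Q.toRightModule e) {p q : P} (hp : p ∈ e.source)
    (h : Q.sittingDuck p = Q.sittingDuck q) :
    Q.division (p, q) = 𝒢.mul (𝒢.inv (e p).2) (e q).2 := by
  obtain ⟨g, hg, rfl⟩ := Q.sittingDuck_eq_iff.1 h
  rw [Q.division_act hg]
  exact he.eq_inv_mul hp hg

theorem contMDiffOn_division :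
    ContMDiffOn (𝓘(ℝ, EP).prod 𝓘(ℝ, EP)) 𝓘(ℝ, EG) ∞ Q.division
      (fibredSquare Q.sittingDuck) := by
  rintro ⟨p, q⟩ hpq
  change Q.sittingDuck p = Q.sittingDuck q at hpq
  obtain ⟨e, hp, hs, he⟩ := Q.locallyTrivial (Q.π p)
  have hps := e.mem_source.2 hp
  have hsource {x y : P} (hx : x ∈ e.source) (h : Q.sittingDuck x = Q.sittingDuck y) :
      y ∈ e.source := by
    rw [e.mem_source, ← Q.shadowProj_sittingDuck, ← h]
    exact e.mem_source.1 hx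
  have hqs := hsource hps hpq
  have hU : e.source ×ˢ (univ : Set P) ∈ 𝓝 (p, q) :=
    (e.open_source.prod isOpen_univ).mem_nhds ⟨hps, mem_univ _⟩
  rw [← contMDiffWithinAt_inter hU]
  have h1 : ContMDiffAt (𝓘(ℝ, EP).prod 𝓘(ℝ, EP)) 𝓘(ℝ, EG) ∞
      (fun x : P × P => 𝒢.inv (e x.1).2) (p, q) :=
    (𝒢.contMDiff_inv _).comp (p, q) (contMDiffAt_snd.comp (p, q)
      (ContMDiffAt.comp (p, q) (hs.contMDiffAt hps) contMDiffAt_fst))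
  have h2 : ContMDiffAt (𝓘(ℝ, EP).prod 𝓘(ℝ, EP)) 𝓘(ℝ, EG) ∞
      (fun x : P × P => (e x.2).2) (p, q) :=
    contMDiffAt_snd.comp (p, q) (ContMDiffAt.comp (p, q) (hs.contMDiffAt hqs) contMDiffAt_snd)
  refine (LieGroupoid.contMDiffWithinAt_mul
    (s := fibredSquare Q.sittingDuck ∩ e.source ×ˢ (univ : Set P))
    h1.contMDiffWithinAt h2.contMDiffWithinAt ?_
    ⟨hpq, hps, mem_univ _⟩).congr ?_ (Q.division_eq he hps hpq)
  · rintro ⟨x, y⟩ ⟨hxy, hx, -⟩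
    rw [𝒢.s_inv]
    exact t_snd_eq_of_sittingDuck_eq he hx hxy
  · rintro ⟨x, y⟩ ⟨hxy, hx, -⟩
    exact Q.division_eq he hx hxy

theorem isDivisionMap_division :
    Q.toRightModule.IsDivisionMap Q.sittingDuck Q.division where
  contMDiffOn := Q.contMDiffOn_division
  t_apply p q h := by
    obtain ⟨g, hg, rfl⟩ := Q.sittingDuck_eq_iff.1 h
    rw [Q.division_act hg, hg]
  act_apply p q h := by
    obtain ⟨g, hg, rfl⟩ := Q.sittingDuck_eq_iff.1 h
    rw [Q.division_act hg]
  apply_act _ _ := Q.division_act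

theorem isPrincipalBundle_sittingDuck [IsManifold 𝓘(ℝ, EM) ∞ M] [IsManifold 𝓘(ℝ, ES) ∞ S] :
    Q.toRightModule.IsPrincipalBundle (𝓘(ℝ, ES).prod 𝓘(ℝ, EM)) Q.sittingDuck where
  submersion := Q.isSurjectiveSubmersion_sittingDuck
  invariant p g hg := (Q.sittingDuck_eq_iff.2 ⟨g, hg, rfl⟩).symm
  diffeo := by
    refine ⟨contMDiffOn_fst.prodMk Q.contMDiffOn_act,
      fun q hq => Q.sittingDuck_eq_iff.2 ⟨q.2, hq, rfl⟩, fun q => (q.1, Q.division q),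
      contMDiffOn_fst.prodMk Q.contMDiffOn_division,
      fun q hq => (Q.isDivisionMap_division.t_apply q.1 q.2 hq).symm,
      fun q hq => Prod.ext rfl (Q.division_act hq),
      fun q hq => Prod.ext rfl (Q.isDivisionMap_division.act_apply q.1 q.2 hq)⟩

/-! ### Canonicity -/

/-- A second shadow `F'` is another quotient of `P` by the orbits, so that `D'` descends to a
bijection from the orbit space. In the trivialisations of the two shadows this is the identity. -/
theorem existsUnique_diffeomorph_of_isShadow [IsManifold 𝓘(ℝ, EM) ∞ M]
    [IsManifold 𝓘(ℝ, ES) ∞ S] {ι : Type*} {e : ι → Bundle.Trivialization G Q.π}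
    {β : ι → ι → S → M → G} (he : Q.IsTrivializingFamily e)
    {F' : Type*} [TopologicalSpace F'] [ChartedSpace (ModelProd ES EM) F']
    {πF' : F' → S} {D' : P → F'} (h : Q.IsShadow e β πF' D') :
    ∃! Φ : Diffeomorph (𝓘(ℝ, ES).prod 𝓘(ℝ, EM)) (𝓘(ℝ, ES).prod 𝓘(ℝ, EM)) Q.Shadow F' ∞,
      (∀ p, Φ (Q.sittingDuck p) = D' p) ∧ ∀ x, πF' (Φ x) = Q.shadowProj x := by
  obtain ⟨τ, hb, hs, -, -, hD⟩ := h
  have hmem {i : ι} {σ : S} (hσ : σ ∈ (e i).baseSet) : σ ∈ (τ i).baseSet := (hb i).symm ▸ hσ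
  have hD' {i : ι} {p : P} (hp : p ∈ (e i).source) :
      D' p = (τ i).toOpenPartialHomeomorph.symm (Q.π p, 𝒢.t (e i p).2) := by
    rw [← hD i _ ((e i).mem_source.1 hp), (e i).symm_apply_mk_proj hp]
  have hπ (p : P) : πF' (D' p) = Q.π p := by
    obtain ⟨i, hi⟩ := he.cover (Q.π p)
    rw [hD' ((e i).mem_source.2 hi), (τ i).proj_symm_apply' (hmem hi)]
  have hfib (p q : P) : Q.sittingDuck p = Q.sittingDuck q ↔ D' p = D' q := by
    suffices Q.π p = Q.π q → (Q.sittingDuck p = Q.sittingDuck q ↔ D' p = D' q) from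
      ⟨fun h => (this (congrArg Q.shadowProj h)).1 h,
        fun h => (this (by rw [← hπ, h, hπ])).2 h⟩
    intro hpq
    obtain ⟨i, hi⟩ := he.cover (Q.π p)
    have hp := (e i).mem_source.2 hi
    have hq : q ∈ (e i).source := (e i).mem_source.2 (hpq ▸ hi)
    rw [Q.sittingDuck_eq_iff]
    refine ((he.equivariant i).orbit_iff hp hq).trans ?_
    rw [hD' hp, hD' hq, hpq]
    refine ⟨fun h => by rw [h.2], fun h => ⟨rfl, ?_⟩⟩
    have := congrArg (τ i) h
    rw [(τ i).apply_symm_apply' (hmem (hpq ▸ hi)), (τ i).apply_symm_apply' (hmem (hpq ▸ hi))] at this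
    exact congrArg Prod.snd this
  let f : Q.Shadow → F' := Quotient.lift D' fun p q h => (hfib p q).1 (Quotient.sound h)
  have hf (p : P) : f (Q.sittingDuck p) = D' p := rfl
  have hfsymm {i : ι} {q : S × M} (hq : q.1 ∈ (e i).baseSet) :
      f ((shadowTrivialization (he.equivariant i)).toOpenPartialHomeomorph.symm q) =
        (τ i).toOpenPartialHomeomorph.symm q := by
    rw [shadowTrivialization_symm_apply, hf, hD i _ hq, 𝒢.t_one]
  have hbij : Function.Bijective f := by
    constructor
    · intro x y hxy
      obtain ⟨p, rfl⟩ := Q.sittingDuck_surjective x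
      obtain ⟨q, rfl⟩ := Q.sittingDuck_surjective y
      exact (hfib p q).2 hxy
    · intro z
      obtain ⟨i, hi⟩ := he.cover (πF' z)
      refine ⟨_, (hfsymm (i := i) (q := (πF' z, (τ i z).2)) hi).trans ?_⟩
      exact (τ i).symm_apply_mk_proj ((τ i).mem_source.2 (hmem hi))
  have hfsmooth : ContMDiff (𝓘(ℝ, ES).prod 𝓘(ℝ, EM)) (𝓘(ℝ, ES).prod 𝓘(ℝ, EM)) ∞ f := by
    intro x
    obtain ⟨i, hi⟩ := he.cover (Q.shadowProj x)
    have hx : x ∈ (shadowTrivialization (he.equivariant i)).source :=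
      (Bundle.Trivialization.mem_source _).2 hi
    refine ContMDiffAt.congr_of_eventuallyEq (ContMDiffAt.comp x
      ((hs i).contMDiffAt_symm (hmem hi))
      ((shadowTrivialization_smooth (he.equivariant i) (he.smooth i)).contMDiffAt hx)) ?_
    refine Filter.eventuallyEq_of_mem
      ((shadowTrivialization (he.equivariant i)).open_source.mem_nhds hx) fun y hy => ?_
    have h := (shadowTrivialization (he.equivariant i)).toOpenPartialHomeomorph.left_inv hy
    conv_lhs => rw [← h]
    exact hfsymm hy
  let Ψ : Q.Shadow ≃ F' := Equiv.ofBijective f hbij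
  have hΨ : ContMDiff (𝓘(ℝ, ES).prod 𝓘(ℝ, EM)) (𝓘(ℝ, ES).prod 𝓘(ℝ, EM)) ∞ Ψ.symm := by
    intro z
    obtain ⟨i, hi⟩ := he.cover (πF' z)
    have hz : z ∈ (τ i).source := (τ i).mem_source.2 (hmem hi)
    refine ContMDiffAt.congr_of_eventuallyEq (ContMDiffAt.comp z
      ((shadowTrivialization_smooth (he.equivariant i) (he.smooth i)).contMDiffAt_symm ?_)
      ((hs i).contMDiffAt hz)) ?_
    · rw [(τ i).coe_fst hz]
      exact hi
    · refine Filter.eventuallyEq_of_mem ((τ i).open_source.mem_nhds hz) fun y hy => ?_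
      rw [Ψ.symm_apply_eq]
      refine Eq.trans ?_ (hfsymm ?_).symm
      · exact ((τ i).toOpenPartialHomeomorph.left_inv hy).symm
      · rw [(τ i).coe_fst hy, ← hb i]
        exact (τ i).mem_source.1 hy
  refine ⟨⟨Ψ, hfsmooth, hΨ⟩, ⟨fun _ => rfl, fun x => ?_⟩, fun Φ hΦ => ?_⟩
  · obtain ⟨p, rfl⟩ := Q.sittingDuck_surjective x
    exact hπ p
  · ext x
    obtain ⟨p, rfl⟩ := Q.sittingDuck_surjective x
    exact hΦ.1 p

end PrincipaloidBundle

end Main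
theorem theoremA
    {EM EG EP ES : Type*} {M G S : Type*} {P : Type u}
    [NormedAddCommGroup EM] [NormedSpace ℝ EM] [FiniteDimensional ℝ EM]
    [NormedAddCommGroup EG] [NormedSpace ℝ EG] [FiniteDimensional ℝ EG]
    [NormedAddCommGroup EP] [NormedSpace ℝ EP] [FiniteDimensional ℝ EP]
    [NormedAddCommGroup ES] [NormedSpace ℝ ES] [FiniteDimensional ℝ ES]
    [TopologicalSpace M] [ChartedSpace EM M] [IsManifold 𝓘(ℝ, EM) ∞ M]
    [T2Space M] [SecondCountableTopology M]
    [TopologicalSpace G] [ChartedSpace EG G] [IsManifold 𝓘(ℝ, EG) ∞ G]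
    [T2Space G] [SecondCountableTopology G]
    [TopologicalSpace P] [ChartedSpace EP P] [IsManifold 𝓘(ℝ, EP) ∞ P]
    [T2Space P] [SecondCountableTopology P]
    [TopologicalSpace S] [ChartedSpace ES S] [IsManifold 𝓘(ℝ, ES) ∞ S]
    [T2Space S] [SecondCountableTopology S]
    (𝒢 : LieGroupoid EM EG M G) (Q : PrincipaloidBundle 𝒢 EP P ES S) :
    -- every trivialising family has a transition cocycle
    (∀ (ι : Type w) (e : ι → Bundle.Trivialization G Q.π), Q.IsTrivializingFamily e →
      ∃ β : ι → ι → S → M → G, Q.IsTransitionCocycle e β) ∧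
    -- the shadow bundle and the sitting-duck map
    ∃ (F : Type u) (_ : TopologicalSpace F) (_ : ChartedSpace (ModelProd ES EM) F)
      (πF : F → S) (D : P → F),
      IsManifold (𝓘(ℝ, ES).prod 𝓘(ℝ, EM)) ∞ F ∧ T2Space F ∧ SecondCountableTopology F ∧
      IsSmoothFibreBundle (𝓘(ℝ, ES).prod 𝓘(ℝ, EM)) 𝓘(ℝ, ES) 𝓘(ℝ, EM) M πF ∧
      (∀ p, πF (D p) = Q.π p) ∧
      -- glued from the transition cocycle, and locally modelled on the target map
      (∀ (ι : Type w) (e : ι → Bundle.Trivialization G Q.π) (β : ι → ι → S → M → G),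
        Q.IsTrivializingFamily e → Q.IsTransitionCocycle e β → Q.IsShadow e β πF D) ∧
      -- principal bundle over `F`, with fibrewise action over the base
      Q.toRightModule.IsPrincipalBundle (𝓘(ℝ, ES).prod 𝓘(ℝ, EM)) D ∧
      (∀ p g, Q.μ p = 𝒢.t g → Q.π (Q.act p g) = Q.π p) ∧
      -- the fibres of `D` are the orbits
      (∀ p q, D p = D q ↔ ∃ g, Q.μ p = 𝒢.t g ∧ Q.act p g = q) ∧
      -- the smooth division map, unique on the fibred square
      (∃ φ : P × P → G, Q.toRightModule.IsDivisionMap D φ ∧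
        ∀ φ' : P × P → G,
          (∀ p₁ p₂, D p₁ = D p₂ →
            𝒢.t (φ' (p₁, p₂)) = Q.μ p₁ ∧ Q.act p₁ (φ' (p₁, p₂)) = p₂) →
          EqOn φ' φ (fibredSquare D)) ∧
      -- canonicity: any shadow, for any trivialising family, is uniquely isomorphic to this one
      (∀ (F' : Type v) (_ : TopologicalSpace F') (_ : ChartedSpace (ModelProd ES EM) F')
        (πF' : F' → S) (D' : P → F'),
        IsManifold (𝓘(ℝ, ES).prod 𝓘(ℝ, EM)) ∞ F' →
        (∃ (ι : Type w) (e : ι → Bundle.Trivialization G Q.π) (β : ι → ι → S → M → G),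
          Q.IsTrivializingFamily e ∧ Q.IsTransitionCocycle e β ∧ Q.IsShadow e β πF' D') →
        ∃! Φ : Diffeomorph (𝓘(ℝ, ES).prod 𝓘(ℝ, EM)) (𝓘(ℝ, ES).prod 𝓘(ℝ, EM)) F F' ∞,
          (∀ p, Φ (D p) = D' p) ∧ ∀ x, πF' (Φ x) = πF x) := by
  refine ⟨fun ι e he => ⟨_, he.isTransitionCocycle⟩, Q.Shadow, inferInstance, inferInstance,
    Q.shadowProj, Q.sittingDuck, inferInstance, inferInstance, Q.secondCountableTopology_shadow,
    Q.isSmoothFibreBundle_shadowProj, Q.shadowProj_sittingDuck,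
    fun _ _ _ he hβ => PrincipaloidBundle.isShadow_sittingDuck he hβ,
    Q.isPrincipalBundle_sittingDuck, Q.π_act, fun _ _ => Q.sittingDuck_eq_iff,
    ⟨Q.division, Q.isDivisionMap_division, ?_⟩, ?_⟩
  · rintro φ' hφ' ⟨p, q⟩ hpq
    obtain ⟨ht, hact⟩ := hφ' p q hpq
    have h := Q.division_act ht.symm
    rw [hact] at h
    exact h.symm
  · rintro F' _ _ πF' D' - ⟨ι, e, β, he, -, hF'⟩
    exact Q.existsUnique_diffeomorph_of_isShadow he hF'
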